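/- Let $n,m,k,\ell$ be non-negative integers with $\ell\ge 2$, $k\ge 3$ and $m=n-k$. An $(n,m)$-system is a family $\mathcal N=\{N_1,\dots,N_\ell\}$ of $k$-element subsets of an $n$-element set $V$ such that $V=\bigcup_{i=1}^{\ell}N_i$ and (i) $\bigcap_{i=1}^{\ell}N_i=\varnothing$, but $\bigcap_{j\ne i}N_j\ne\varnothing$ for every $i=1,\dots,\ell$; (ii) every $X\subseteq V$ with $|X|=k+1$ contains a set $T\subseteq X$ with $|T|=3$ and $T\not\subseteq N_i$ for all $i=1,\dots,\ell$. Theorem. Every $(n,m)$-system satisfies $n\le m^2+6m+2$. Likewise, every $\tau$-critical $3$-uniform hypergraph with $n$ vertices and transversal number $m$ satisfies $n\le m^2+6m+2$. Here the transversal number $\tau(H)$ of a finite hypergraph $H$ is the least size of a vertex set that meets every edge, and $H$ is $\tau$-critical if it has no isolated vertices and deleting any edge decreases $\tau$. -/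

import Mathlib

/-- The indexed family `N 0, …, N (ℓ - 1)` of subsets of an `n`-element ground set is an
`(n,m)`-system: all its members have size `k`, where `m = n - k`. -/
structure IsNMSystem (n m k ℓ : ℕ) (N : Fin ℓ → Finset (Fin n)) : Prop where
  two_le : 2 ≤ ℓ
  three_le : 3 ≤ k
  /-- `m = n - k`, as integers. -/
  add_eq : k + m = n
  card_eq : ∀ i, (N i).card = k
  /-- The members cover the ground set. -/
  iUnion_eq : (⋃ i, (N i : Set (Fin n))) = Set.univ
  /-- The members have no common element. -/
  iInter_eq : (⋂ i, (N i : Set (Fin n))) = ∅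
  /-- Any `ℓ - 1` of the members have a common element. -/
  iInter_ne : ∀ i, (⋂ (j : Fin ℓ) (_ : j ≠ i), (N j : Set (Fin n))).Nonempty
  /-- Every `(k+1)`-set contains a triple that lies in no member. -/
  exists_triple : ∀ X : Finset (Fin n), X.card = k + 1 →
    ∃ T : Finset (Fin n), T ⊆ X ∧ T.card = 3 ∧ ∀ i, ¬ T ⊆ N i

/-- `T` meets every edge of the hypergraph with edge set `E`. -/
def IsTransversal {V : Type*} [DecidableEq V] (E : Finset (Finset V)) (T : Finset V) : Prop :=
  ∀ e ∈ E, (e ∩ T).Nonempty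

/-- The least size of a transversal. (It is used for nonempty edges, where transversals exist.) -/
noncomputable def transversalNumber {V : Type*} [DecidableEq V] (E : Finset (Finset V)) : ℕ :=
  sInf {t : ℕ | ∃ T : Finset V, IsTransversal E T ∧ T.card = t}

/-- The hypergraph with vertex set `V` and edge set `E` is `τ`-critical: it has no isolated
vertex, and deleting any edge decreases the transversal number. -/
structure IsTauCritical {V : Type*} [DecidableEq V] (E : Finset (Finset V)) : Prop where
  no_isolated : ∀ v : V, ∃ e ∈ E, v ∈ e
  erase_lt : ∀ e ∈ E, transversalNumber (E.erase e) < transversalNumber E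

/-!
Both claims reduce to a bound on the number of vertices of a `3`-uniform `τ`-critical hypergraph
with transversal number `t`: the triples lying in no member of an `(n,m)`-system have transversal
number `m`, and a minimal subfamily with the same transversal number has no isolated vertices,
since the complements of the members are minimum transversals that cover the ground set
(`IsNMSystem.exists_isCritical`).

For a critical hypergraph, fix a minimum transversal `T₀` and a maximal set `M` of edges that meet
the complement of `T₀` in pairwise disjoint pairs. Let `S` be the set of vertices outside `T₀` and
outside these pairs. There are `t + 2 |M| + |S|` vertices, and the two summands are bounded as
follows.

* Let `p z` be the number of edges of `M` through `z ∈ T₀`. A transversal `T` of size `t` needs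
  `∑ z ∈ T₀ \ T, p z` vertices to hit the disjoint pairs at the vertices it misses, so this sum is
  at most `|T₀ \ T|`. Every `z` is missed by some `T`; hence `p z ≤ k + 1` if `k` vertices of `T₀`
  have `p = 0`. This gives `|M| ≤ (t - k) (k + 1) ≤ (t + 1)² / 4`
  (`IsPetalMatching.four_mul_card_le`).
* By maximality of `M`, every edge meets `S` in at most one vertex. Criticality implies Hall's
  condition for the links of the vertices of `S` (`IsCritical.card_le_card_biUnion_link`), so there
  are distinct pairs `A v` such that all `A v ∪ {v}` are edges. A transversal of the hypergraph
  without the edge `A v ∪ {v}`, with its vertices in `S` exchanged for suitable vertices of the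
  pairs, yields a set `C v` of size less than `t` that misses `A v` and meets every other `A u`.
  Bollobás's set-pair inequality gives `|S| ≤ (t + 1).choose 2` (`IsCritical.card_le_choose_two`).

Altogether twice the number of vertices is at most `2 t² + 5 t + 1`.
-/

section

open Finset

/-! ### Hall's theorem and the set-pair inequality -/

/-- Hall's marriage theorem, for the indices in a finset. -/
theorem Finset.exists_injOn_of_card_le_card_biUnion {ι α : Type*} [DecidableEq ι] [DecidableEq α]
    [Inhabited α] (S : Finset ι) (L : ι → Finset α)
    (h : ∀ S' ⊆ S, S'.card ≤ (S'.biUnion L).card) :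
    ∃ f : ι → α, Set.InjOn f S ∧ ∀ u ∈ S, f u ∈ L u := by
  obtain ⟨g, hg, hgL⟩ := (Finset.all_card_le_biUnion_card_iff_exists_injective
    (fun u : S => L u)).1 (fun s => by
      have := h (s.image Subtype.val) (fun x hx => by
        obtain ⟨y, -, rfl⟩ := Finset.mem_image.1 hx
        exact y.2)
      rwa [Finset.card_image_of_injective _ Subtype.val_injective, Finset.image_biUnion] at this)
  refine ⟨fun u => if hu : u ∈ S then g ⟨u, hu⟩ else default, ?_, ?_⟩
  · intro u hu w hw huw
    have hu' : u ∈ S := hu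
    have hw' : w ∈ S := hw
    simp only [hu', hw', dif_pos] at huw
    exact congrArg Subtype.val (hg huw)
  · intro u hu
    simpa [hu] using hgL ⟨u, hu⟩

open Polynomial in
/-- Bollobás's set-pair inequality for pairs against sets with fewer than `t` elements. With the
points placed injectively in `ℚ` and `P i = ∏ c ∈ C i, (X - c)`, evaluation at the points of the
pairs shows that the polynomials `P i (x) * P i (y)` are linearly independent. They are symmetric
and of degree less than `t` in each variable, so their coefficients are functions on
`Sym2 (Fin t)`. -/
theorem card_le_choose_two_of_cross_intersecting {V ι : Type*} [Fintype V] [DecidableEq V]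
    [Fintype ι] (A C : ι → Finset V) (t : ℕ) (hA : ∀ i, (A i).card = 2)
    (hC : ∀ i, (C i).card < t) (hd : ∀ i, Disjoint (A i) (C i))
    (hx : ∀ i j, i ≠ j → ¬ Disjoint (A i) (C j)) :
    Fintype.card ι ≤ (t + 1).choose 2 := by
  classical
  let g : V → ℚ := fun v => ((Fintype.equivFin V v : ℕ) : ℚ)
  have hg : Function.Injective g := fun a b hab => by
    simpa [g, Fin.ext_iff, Fin.val_inj] using hab
  let P : ι → ℚ[X] := fun i => ∏ c ∈ C i, (X - Polynomial.C (g c))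
  have hPdeg : ∀ i, (P i).natDegree < t := fun i => by
    simpa [P, natDegree_prod_of_monic, monic_X_sub_C] using hC i
  have hPev : ∀ i v, (P i).eval (g v) = 0 ↔ v ∈ C i := fun i v => by
    simp only [P, eval_prod, Finset.prod_eq_zero_iff, eval_sub, eval_X, eval_C, sub_eq_zero]
    exact ⟨fun ⟨c, hc, h⟩ => hg h ▸ hc, fun h => ⟨v, h, rfl⟩⟩
  let w : ι → Sym2 (Fin t) → ℚ := fun i =>
    Sym2.lift ⟨fun a b => (P i).coeff a * (P i).coeff b, fun _ _ => mul_comm _ _⟩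
  have hw : LinearIndependent ℚ w := by
    rw [Fintype.linearIndependent_iff]
    intro l hl i
    have hcoeff : ∀ a b : Fin t, ∑ j, l j * ((P j).coeff a * (P j).coeff b) = 0 := fun a b => by
      simpa [w, Finset.sum_apply] using congrFun hl s(a, b)
    have heval : ∀ x y : ℚ, ∑ j, l j * ((P j).eval x * (P j).eval y) = 0 := fun x y => by
      have h1 : ∀ j x, (P j).eval x = ∑ a : Fin t, (P j).coeff a * x ^ (a : ℕ) := fun j x => by
        rw [eval_eq_sum_range' (hPdeg j), Finset.sum_range]
      calc ∑ j, l j * ((P j).eval x * (P j).eval y)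
          = ∑ j, ∑ a : Fin t, ∑ b : Fin t,
              x ^ (a : ℕ) * y ^ (b : ℕ) * (l j * ((P j).coeff a * (P j).coeff b)) := by
            refine Finset.sum_congr rfl fun j _ => ?_
            rw [h1 j x, h1 j y, Finset.sum_mul_sum, Finset.mul_sum]
            refine Finset.sum_congr rfl fun a _ => ?_
            rw [Finset.mul_sum]
            exact Finset.sum_congr rfl fun b _ => by ring
        _ = ∑ a : Fin t, ∑ b : Fin t, x ^ (a : ℕ) * y ^ (b : ℕ) *
              ∑ j, l j * ((P j).coeff a * (P j).coeff b) := by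
            rw [Finset.sum_comm]
            refine Finset.sum_congr rfl fun a _ => ?_
            rw [Finset.sum_comm]
            exact Finset.sum_congr rfl fun b _ => (Finset.mul_sum _ _ _).symm
        _ = 0 := by simp [hcoeff]
    obtain ⟨a, b, -, hab⟩ := Finset.card_eq_two.1 (hA i)
    have hsingle := heval (g a) (g b)
    rw [Finset.sum_eq_single i] at hsingle
    · have ha : (P i).eval (g a) ≠ 0 := fun h =>
        Finset.disjoint_left.1 (hd i) (by simp [hab]) ((hPev i a).1 h)
      have hb : (P i).eval (g b) ≠ 0 := fun h =>
        Finset.disjoint_left.1 (hd i) (by simp [hab]) ((hPev i b).1 h)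
      exact (mul_eq_zero.1 hsingle).resolve_right (mul_ne_zero ha hb)
    · intro j _ hji
      obtain ⟨c, hcA, hcC⟩ := Finset.not_disjoint_iff.1 (hx i j hji.symm)
      have h0 := (hPev j c).2 hcC
      rw [hab, Finset.mem_insert, Finset.mem_singleton] at hcA
      rcases hcA with rfl | rfl <;> simp [h0]
    · simp
  simpa [Sym2.card] using hw.fintype_card_le_finrank

/-! ### Critical hypergraphs -/

/-- A `3`-uniform `τ`-critical hypergraph with transversal number `t`. That the transversal number
is not smaller than `t` and drops below `t` when an edge is deleted is stated in terms of
transversals; that it is not larger follows (`IsCritical.exists_transversal`). -/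
structure IsCritical {V : Type*} [DecidableEq V] (E : Finset (Finset V)) (t : ℕ) : Prop where
  card_eq : ∀ e ∈ E, e.card = 3
  no_isolated : ∀ v, ∃ e ∈ E, v ∈ e
  le_card : ∀ T, IsTransversal E T → t ≤ T.card
  exists_erase : ∀ e ∈ E, ∃ T, IsTransversal (E.erase e) T ∧ T.card < t

variable {V : Type*} [DecidableEq V] {E : Finset (Finset V)} {t : ℕ}

/-- A set of fewer than `t` vertices that meets all edges but `e` is disjoint from `e`. -/
theorem IsCritical.exists_disjoint (h : IsCritical E t) {e : Finset V} (he : e ∈ E) :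
    ∃ T, Disjoint e T ∧ T.card < t ∧ ∀ g ∈ E, g ≠ e → (g ∩ T).Nonempty := by
  obtain ⟨T, hT, hTt⟩ := h.exists_erase e he
  refine ⟨T, ?_, hTt, fun g hg hge => hT g (mem_erase.2 ⟨hge, hg⟩)⟩
  by_contra hd
  refine absurd (h.le_card T fun g hg => ?_) (not_le.2 hTt)
  by_cases hge : g = e
  · subst hge
    rwa [Finset.not_disjoint_iff_nonempty_inter] at hd
  · exact hT g (mem_erase.2 ⟨hge, hg⟩)

theorem IsCritical.exists_transversal_notMem (h : IsCritical E t) (z : V) :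
    ∃ T, IsTransversal E T ∧ T.card = t ∧ z ∉ T := by
  obtain ⟨e, he, hze⟩ := h.no_isolated z
  obtain ⟨v, hve, hvz⟩ := Finset.exists_mem_ne (by rw [h.card_eq e he]; norm_num) z
  obtain ⟨T, hd, hTt, hT⟩ := h.exists_disjoint he
  have htr : IsTransversal E (insert v T) := fun g hg => by
    by_cases hge : g = e
    · exact ⟨v, by simp [hge, hve]⟩
    · exact (hT g hg hge).mono (Finset.inter_subset_inter_left (Finset.subset_insert _ _))
  refine ⟨insert v T, htr, le_antisymm ((Finset.card_insert_le _ _).trans hTt)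
    (h.le_card _ htr), ?_⟩
  rw [Finset.mem_insert, not_or]
  exact ⟨hvz.symm, Finset.disjoint_left.1 hd hze⟩

theorem IsCritical.exists_transversal (h : IsCritical E t) :
    ∃ T, IsTransversal E T ∧ T.card = t := by
  rcases E.eq_empty_or_nonempty with rfl | ⟨e, he⟩
  · have h0 : IsTransversal (∅ : Finset (Finset V)) ∅ := fun e he => by simp at he
    exact ⟨∅, h0, (Nat.le_zero.1 (h.le_card ∅ h0)).symm⟩
  · obtain ⟨z, -⟩ := Finset.card_pos.1 (by rw [h.card_eq e he]; norm_num : 0 < e.card)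
    obtain ⟨T, hT, hc, -⟩ := h.exists_transversal_notMem z
    exact ⟨T, hT, hc⟩

/-- The link of the vertex `v`: the sets `e \ {v}` for the edges `e` that contain `v`. -/
def link (E : Finset (Finset V)) (v : V) : Finset (Finset V) :=
  (E.filter (v ∈ ·)).image (·.erase v)

theorem mem_link {v : V} {A : Finset V} : A ∈ link E v ↔ v ∉ A ∧ insert v A ∈ E := by
  simp only [link, mem_image, mem_filter]
  constructor
  · rintro ⟨e, ⟨he, hv⟩, rfl⟩
    exact ⟨by simp, by rwa [Finset.insert_erase hv]⟩
  · rintro ⟨hv, hA⟩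
    exact ⟨_, ⟨hA, by simp⟩, Finset.erase_insert hv⟩

/-- Hall's condition for the links of a set `S` that meets every edge in at most one vertex. In a
minimal violator, the vertices of `S` other than a given `v` match all pairs in the links. Take a
transversal `T` of the hypergraph without an edge `e ∋ v`, and replace its vertices in `S` by one
vertex of each pair disjoint from `T`. The result is no larger than `T`, and it meets every edge,
`e` included. -/
theorem IsCritical.card_le_card_biUnion_link (h : IsCritical E t) {S : Finset V}
    (hS : ∀ e ∈ E, (e ∩ S).card ≤ 1) : S.card ≤ (S.biUnion (link E)).card := by
  induction S using Finset.strongInduction with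
  | H S ih =>
  have hsub : ∀ S' ⊂ S, S'.card ≤ (S'.biUnion (link E)).card := fun S' hS' => ih S' hS' fun e he =>
    (card_le_card (inter_subset_inter_left hS'.1)).trans (hS e he)
  by_contra! hlt
  obtain ⟨v, hv⟩ : S.Nonempty := Finset.card_pos.1 (by omega)
  have huniq : ∀ e ∈ E, ∀ x ∈ S, ∀ y ∈ S, x ∈ e → y ∈ e → x = y := fun e he x hx y hy hxe hye =>
    Finset.card_le_one.1 (hS e he) x (by simp [*]) y (by simp [*])
  obtain ⟨f, hf, hfL⟩ := Finset.exists_injOn_of_card_le_card_biUnion (S.erase v) (link E)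
    (fun S' hS' => hsub S' (hS'.trans_ssubset (erase_ssubset hv)))
  have himage : (S.erase v).image f = S.biUnion (link E) := by
    apply Finset.eq_of_subset_of_card_le
    · intro A hA
      obtain ⟨u, hu, rfl⟩ := mem_image.1 hA
      exact mem_biUnion.2 ⟨u, mem_of_mem_erase hu, hfL u hu⟩
    · rw [card_image_of_injOn hf, card_erase_of_mem hv]
      omega
  obtain ⟨e, he, hve⟩ := h.no_isolated v
  obtain ⟨T, hd, hTt, hT⟩ := h.exists_disjoint he
  let Q := (S.biUnion (link E)).filter (Disjoint · T)
  -- A pair disjoint from `T` is matched to a vertex whose edge is met by `T` in that vertex only.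
  have hQ : Q.card ≤ (T ∩ S).card := by
    refine (card_le_card (t := (T ∩ S).image f) fun A hA => ?_).trans card_image_le
    obtain ⟨hA, hAT⟩ := mem_filter.1 hA
    rw [← himage] at hA
    obtain ⟨u, hu, rfl⟩ := mem_image.1 hA
    obtain ⟨huv, huS⟩ := mem_erase.1 hu
    have hg := (mem_link.1 (hfL u hu)).2
    obtain ⟨x, hx⟩ := hT _ hg fun heq =>
      huv (huniq e he u huS v hv (heq ▸ mem_insert_self _ _) hve)
    obtain ⟨hx, hxT⟩ := mem_inter.1 hx
    rcases mem_insert.1 hx with rfl | hx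
    · exact mem_image_of_mem f (mem_inter.2 ⟨hxT, huS⟩)
    · exact absurd hxT (disjoint_left.1 hAT hx)
  have hpick : ∀ A ∈ S.biUnion (link E), ∃ a, a ∈ A := fun A hA => by
    obtain ⟨u, -, hu⟩ := mem_biUnion.1 hA
    obtain ⟨huA, hg⟩ := mem_link.1 hu
    have := h.card_eq _ hg
    rw [card_insert_of_notMem huA] at this
    exact card_pos.1 (by omega)
  have : Nonempty V := ⟨v⟩
  choose! a ha using hpick
  have htr : IsTransversal E (T \ S ∪ Q.image a) := fun g hg => by
    by_cases hgS : ∃ u ∈ S, u ∈ g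
    · obtain ⟨u, hu, hug⟩ := hgS
      have hA : g.erase u ∈ S.biUnion (link E) :=
        mem_biUnion.2 ⟨u, hu, mem_link.2 ⟨by simp, by rwa [insert_erase hug]⟩⟩
      by_cases hAT : Disjoint (g.erase u) T
      · exact ⟨a (g.erase u), mem_inter.2 ⟨mem_of_mem_erase (ha _ hA), mem_union_right _
          (mem_image_of_mem a (mem_filter.2 ⟨hA, hAT⟩))⟩⟩
      · obtain ⟨x, hx, hxT⟩ := not_disjoint_iff.1 hAT
        obtain ⟨hxu, hxg⟩ := mem_erase.1 hx
        exact ⟨x, mem_inter.2 ⟨hxg, mem_union_left _ (mem_sdiff.2 ⟨hxT, fun hxS =>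
          hxu (huniq g hg x hxS u hu hxg hug)⟩)⟩⟩
    · push Not at hgS
      obtain ⟨x, hx⟩ := hT g hg fun heq => hgS v hv (heq ▸ hve)
      obtain ⟨hxg, hxT⟩ := mem_inter.1 hx
      exact ⟨x, mem_inter.2 ⟨hxg, mem_union_left _ (mem_sdiff.2 ⟨hxT, fun hxS => hgS x hxS hxg⟩)⟩⟩
  have h1 := h.le_card _ htr
  have h2 : (T \ S ∪ Q.image a).card ≤ (T \ S).card + Q.card :=
    (card_union_le _ _).trans (Nat.add_le_add_left card_image_le _)
  have h3 := card_sdiff_add_card_inter T S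
  omega

/-- A set that meets every edge in at most one vertex has at most `(t + 1).choose 2` vertices. -/
theorem IsCritical.card_le_choose_two [Fintype V] (h : IsCritical E t) {S : Finset V}
    (hS : ∀ e ∈ E, (e ∩ S).card ≤ 1) : S.card ≤ (t + 1).choose 2 := by
  have huniq : ∀ e ∈ E, ∀ x ∈ S, ∀ y ∈ S, x ∈ e → y ∈ e → x = y := fun e he x hx y hy hxe hye =>
    Finset.card_le_one.1 (hS e he) x (by simp [*]) y (by simp [*])
  obtain ⟨A, hAinj, hAL⟩ := Finset.exists_injOn_of_card_le_card_biUnion S (link E)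
    (fun S' hS' => h.card_le_card_biUnion_link fun e he =>
      (card_le_card (inter_subset_inter_left hS')).trans (hS e he))
  have hA2 : ∀ v ∈ S, (A v).card = 2 := fun v hv => by
    obtain ⟨hvA, hg⟩ := mem_link.1 (hAL v hv)
    have := h.card_eq _ hg
    rw [card_insert_of_notMem hvA] at this
    omega
  have hC : ∀ v ∈ S, ∃ C : Finset V, C.card < t ∧ Disjoint (A v) C ∧
      ∀ u ∈ S, u ≠ v → ¬ Disjoint (A u) C := fun v hv => by
    obtain ⟨T, hd, hTt, hT⟩ := h.exists_disjoint (mem_link.1 (hAL v hv)).2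
    have hpick : ∀ u ∈ S.erase v, ∃ c ∈ A u, c ∉ A v := fun u hu => by
      obtain ⟨huv, hu⟩ := mem_erase.1 hu
      by_contra! hsub
      exact huv (hAinj hu hv
        (eq_of_subset_of_card_le hsub (by rw [hA2 u hu, hA2 v hv])))
    choose! c hcu hcv using hpick
    let F := ((S.erase v) ∩ T)
    -- The pairs that `T \ S` misses belong to vertices `u ∈ F`; `c u` hits them and avoids `A v`.
    refine ⟨T \ S ∪ F.image c, ?_, ?_, ?_⟩
    · have h2 : (T \ S ∪ F.image c).card ≤ (T \ S).card + F.card :=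
        (card_union_le _ _).trans (Nat.add_le_add_left card_image_le _)
      have h3 := card_sdiff_add_card_inter T S
      have h4 : F.card ≤ (T ∩ S).card :=
        card_le_card fun x hx => by
          simp only [F, mem_inter, mem_erase] at hx ⊢
          exact ⟨hx.2, hx.1.2⟩
      omega
    · rw [disjoint_left]
      intro x hx hxC
      rcases mem_union.1 hxC with hxC | hxC
      · exact disjoint_left.1 hd (mem_insert_of_mem hx) (mem_sdiff.1 hxC).1
      · obtain ⟨u, hu, rfl⟩ := mem_image.1 hxC
        exact hcv u (mem_inter.1 hu).1 hx
    · intro u hu huv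
      rw [not_disjoint_iff]
      have hug := (mem_link.1 (hAL u hu)).2
      obtain ⟨x, hx⟩ := hT _ hug fun heq => huv <|
        huniq _ hug u hu v hv (mem_insert_self _ _) (heq ▸ mem_insert_self _ _)
      obtain ⟨hx, hxT⟩ := mem_inter.1 hx
      rcases mem_insert.1 hx with rfl | hxA
      · have hxv := mem_erase.2 ⟨huv, hu⟩
        exact ⟨c x, hcu x hxv, mem_union_right _ (mem_image_of_mem c (mem_inter.2 ⟨hxv, hxT⟩))⟩
      · refine ⟨x, hxA, mem_union_left _ (mem_sdiff.2 ⟨hxT, fun hxS => ?_⟩)⟩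
        have := huniq _ hug x hxS u hu hx (mem_insert_self _ _)
        exact (mem_link.1 (hAL u hu)).1 (this ▸ hxA)
  choose! C hCt hCd hCx using hC
  simpa using card_le_choose_two_of_cross_intersecting (fun v : S => A v) (fun v : S => C v) t
    (fun v => hA2 v v.2) (fun v => hCt v v.2) (fun v => hCd v v.2)
    (fun u v huv => hCx v v.2 u u.2 fun heq => huv (Subtype.ext heq))

/-! ### Petal matchings -/

/-- A petal matching relative to a transversal `T₀`: a set of edges that meet the complement of `T₀`
in pairwise disjoint pairs. In a `3`-uniform hypergraph each of its edges then has exactly one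
vertex in `T₀`, so the pairs are the petals of sunflowers with kernels in `T₀`. -/
structure IsPetalMatching (E : Finset (Finset V)) (T₀ : Finset V) (M : Finset (Finset V)) :
    Prop where
  subset : M ⊆ E
  card_sdiff : ∀ e ∈ M, (e \ T₀).card = 2
  disjoint : ∀ e ∈ M, ∀ g ∈ M, e ≠ g → Disjoint (e \ T₀) (g \ T₀)

theorem exists_maximal_isPetalMatching (E : Finset (Finset V)) (T₀ : Finset V) :
    ∃ M, IsPetalMatching E T₀ M ∧ ∀ M', IsPetalMatching E T₀ M' → M ⊆ M' → M' = M := by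
  classical
  have hne : (E.powerset.filter (IsPetalMatching E T₀)).Nonempty :=
    ⟨∅, mem_filter.2 ⟨by simp, by simp, by simp, by simp⟩⟩
  obtain ⟨M, hM, hmax⟩ := exists_max_image _ card hne
  refine ⟨M, (mem_filter.1 hM).2, fun M' hM' hsub => (eq_of_subset_of_card_le hsub ?_).symm⟩
  exact hmax M' (mem_filter.2 ⟨mem_powerset.2 hM'.subset, hM'⟩)

theorem IsPetalMatching.card_inter (h : IsCritical E t) {T₀ : Finset V} {M : Finset (Finset V)}
    (hM : IsPetalMatching E T₀ M) {e : Finset V} (he : e ∈ M) : (T₀ ∩ e).card = 1 := by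
  have h1 := card_sdiff_add_card_inter e T₀
  rw [hM.card_sdiff e he, h.card_eq e (hM.subset he), inter_comm] at h1
  omega

/-- A transversal `T` that misses `z ∈ T₀` must hit the petals at `z` outside `T₀`, in distinct
vertices as the petals are disjoint. -/
theorem IsPetalMatching.sum_card_le {T₀ T : Finset V} {M : Finset (Finset V)}
    (hM : IsPetalMatching E T₀ M) (h : IsCritical E t) (hT : IsTransversal E T) :
    ∑ z ∈ T₀ \ T, (M.filter (z ∈ ·)).card ≤ (T \ T₀).card := by
  have hpick : ∀ e ∈ M, ∃ x, x ∈ e ∧ x ∈ T := fun e he => by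
    obtain ⟨x, hx⟩ := hT e (hM.subset he)
    exact ⟨x, mem_inter.1 hx⟩
  rw [← card_biUnion]
  · rcases isEmpty_or_nonempty V with hV | hV
    · simp [Finset.eq_empty_of_isEmpty T₀]
    choose! x hxe hxT using hpick
    have hx0 : ∀ e ∈ (T₀ \ T).biUnion (fun z => M.filter (z ∈ ·)), e ∈ M ∧ x e ∉ T₀ := fun e he => by
      obtain ⟨z, hz, he⟩ := mem_biUnion.1 he
      obtain ⟨heM, hze⟩ := mem_filter.1 he
      obtain ⟨hz0, hzT⟩ := mem_sdiff.1 hz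
      refine ⟨heM, fun hx => hzT ?_⟩
      have := card_le_one.1 (hM.card_inter h heM).le z (mem_inter.2 ⟨hz0, hze⟩) (x e)
        (mem_inter.2 ⟨hx, hxe e heM⟩)
      exact this ▸ hxT e heM
    refine card_le_card_of_injOn x (fun e he => ?_) (fun e he g hg heg => ?_)
    · exact mem_sdiff.2 ⟨hxT e (hx0 e he).1, (hx0 e he).2⟩
    · by_contra hne
      obtain ⟨heM, hxe0⟩ := hx0 e he
      obtain ⟨hgM, hxg0⟩ := hx0 g hg
      exact disjoint_left.1 (hM.disjoint e heM g hgM hne) (mem_sdiff.2 ⟨hxe e heM, hxe0⟩)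
        (mem_sdiff.2 ⟨heg ▸ hxe g hgM, hxe0⟩)
  · intro z hz w hw hzw
    refine disjoint_left.2 fun e he he' => hzw ?_
    obtain ⟨heM, hze⟩ := mem_filter.1 he
    exact card_le_one.1 (hM.card_inter h heM).le z
      (mem_inter.2 ⟨(mem_sdiff.1 hz).1, hze⟩) w
      (mem_inter.2 ⟨(mem_sdiff.1 hw).1, (mem_filter.1 he').2⟩)

/-- A petal matching relative to a minimum transversal has at most `(t + 1)² / 4` edges: if `k`
vertices of `T₀` carry no petal, each of the `t - k` others carries at most `k + 1`. -/
theorem IsPetalMatching.four_mul_card_le {T₀ : Finset V} {M : Finset (Finset V)}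
    (hM : IsPetalMatching E T₀ M) (h : IsCritical E t) (ht : T₀.card = t) :
    4 * M.card ≤ (t + 1) ^ 2 := by
  let p : V → ℕ := fun z => (M.filter (z ∈ ·)).card
  let K := T₀.filter (p · = 0)
  have hp : ∀ z ∈ T₀, p z ≤ K.card + 1 := fun z hz => by
    obtain ⟨T, hT, hTt, hzT⟩ := h.exists_transversal_notMem z
    have h1 : ∑ w ∈ T₀ \ T, p w ≤ (T₀ \ T).card :=
      (hM.sum_card_le h hT).trans_eq (card_sdiff_comm (hTt.trans ht.symm))
    have hzD : z ∈ T₀ \ T := mem_sdiff.2 ⟨hz, hzT⟩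
    rw [← add_sum_erase _ _ hzD] at h1
    -- Vertices of `T₀ \ T` outside `K` contribute at least `1` each to the sum in `h1`.
    have h2 : (((T₀ \ T).erase z) \ K).card ≤ ∑ w ∈ (T₀ \ T).erase z, p w := by
      rw [card_eq_sum_ones]
      refine (sum_le_sum fun w hw => ?_).trans (sum_le_sum_of_subset sdiff_subset)
      obtain ⟨hw, hwK⟩ := mem_sdiff.1 hw
      have hw0 : w ∈ T₀ := (mem_sdiff.1 (mem_of_mem_erase hw)).1
      exact Nat.one_le_iff_ne_zero.2 fun h0 => hwK (mem_filter.2 ⟨hw0, h0⟩)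
    have h3 := le_card_sdiff K ((T₀ \ T).erase z)
    rw [card_erase_of_mem hzD] at h3
    have h4 := card_pos.2 ⟨z, hzD⟩
    omega
  have hsum : M.card = ∑ z ∈ T₀, p z := by
    have h1 : ∑ z ∈ T₀, p z = ∑ e ∈ M, (T₀ ∩ e).card := by
      simp only [p, card_filter]
      rw [sum_comm]
      refine sum_congr rfl fun e _ => ?_
      rw [← card_filter, filter_mem_eq_inter]
    rw [h1, sum_congr rfl fun e he => hM.card_inter h he, card_eq_sum_ones]
  have hle : M.card ≤ (t - K.card) * (K.card + 1) := by
    have hK : K ⊆ T₀ := filter_subset _ _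
    rw [hsum, ← sum_sdiff hK, sum_eq_zero (s := K) fun z hz => (mem_filter.1 hz).2, add_zero,
      ← ht, ← card_sdiff_of_subset hK]
    exact sum_le_card_nsmul _ _ _ fun z hz => hp z (mem_sdiff.1 hz).1
  have hKt : K.card ≤ t := ht ▸ card_le_card (filter_subset _ _)
  obtain ⟨j, hj⟩ := Nat.exists_eq_add_of_le hKt
  rw [hj, Nat.add_sub_cancel_left] at hle
  rw [hj]
  zify at hle ⊢
  -- With `t = |K| + j` this is `4 * j * (|K| + 1) ≤ (j + |K| + 1) ^ 2`.
  nlinarith [sq_nonneg ((j : ℤ) - (K.card + 1))]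

/-- By maximality, an edge with two vertices in `S` could be added to the matching. -/
theorem IsPetalMatching.card_inter_le_one {T₀ : Finset V} {M : Finset (Finset V)}
    (hM : IsPetalMatching E T₀ M) (hmax : ∀ M', IsPetalMatching E T₀ M' → M ⊆ M' → M' = M)
    (h : IsCritical E t) (hT₀ : IsTransversal E T₀) {S : Finset V}
    (hS₀ : Disjoint S T₀) (hS : ∀ e ∈ M, Disjoint S (e \ T₀)) {e : Finset V} (he : e ∈ E) :
    (e ∩ S).card ≤ 1 := by
  by_contra! hlt
  have hsub : e ∩ S ⊆ e \ T₀ := fun x hx => by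
    obtain ⟨hxe, hxS⟩ := mem_inter.1 hx
    exact mem_sdiff.2 ⟨hxe, disjoint_left.1 hS₀ hxS⟩
  have h1 := card_sdiff_add_card_inter e T₀
  rw [h.card_eq e he] at h1
  have h2 := card_pos.2 (hT₀ e he)
  have heq : e ∩ S = e \ T₀ := eq_of_subset_of_card_le hsub (by omega)
  have heS : e \ T₀ ⊆ S := heq ▸ inter_subset_right
  have hcard : (e \ T₀).card = 2 := by
    have := card_le_card hsub
    omega
  have hd : ∀ g ∈ M, Disjoint (e \ T₀) (g \ T₀) := fun g hg => (hS g hg).mono_left heS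
  have hins : IsPetalMatching E T₀ (insert e M) := by
    refine ⟨insert_subset he hM.subset, ?_, ?_⟩
    · intro g hg
      rcases mem_insert.1 hg with rfl | hg
      exacts [hcard, hM.card_sdiff g hg]
    · intro g hg g' hg' hne
      rcases mem_insert.1 hg with rfl | hgM <;> rcases mem_insert.1 hg' with rfl | hgM'
      exacts [absurd rfl hne, hd _ hgM', (hd _ hgM).symm, hM.disjoint g hgM g' hgM' hne]
  have heM : e ∈ M := hmax _ hins (subset_insert _ _) ▸ mem_insert_self e M
  have := disjoint_self.1 (hd e heM)
  rw [this] at hcard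
  simp at hcard

/-! ### The order of a critical hypergraph -/

theorem IsCritical.two_mul_card_le [Fintype V] (h : IsCritical E t) :
    2 * Fintype.card V ≤ 2 * t ^ 2 + 5 * t + 1 := by
  obtain ⟨T₀, hT₀, ht⟩ := h.exists_transversal
  obtain ⟨M, hM, hmax⟩ := exists_maximal_isPetalMatching E T₀
  let U := M.biUnion (· \ T₀)
  have hU : U.card ≤ M.card * 2 := card_biUnion_le_card_mul _ _ _ fun e he => (hM.card_sdiff e he).le
  let S := (T₀ ∪ U)ᶜ
  have hS : ∀ e ∈ E, (e ∩ S).card ≤ 1 := fun e he => by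
    refine hM.card_inter_le_one hmax h hT₀ (disjoint_left.2 fun x hx hx0 => ?_)
      (fun g hg => disjoint_left.2 fun x hx hxg => ?_) he
    · exact mem_compl.1 hx (mem_union_left _ hx0)
    · exact mem_compl.1 hx (mem_union_right _ (mem_biUnion.2 ⟨g, hg, hxg⟩))
  have h1 := h.card_le_choose_two hS
  have h2 := hM.four_mul_card_le h ht
  have h3 := card_add_card_compl (T₀ ∪ U)
  have h4 := card_union_le T₀ U
  have h5 : S.card * 2 ≤ (t + 1) * t := by
    rw [Nat.choose_two_right, Nat.add_sub_cancel] at h1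
    exact (Nat.mul_le_mul_right 2 h1).trans (Nat.div_mul_le_self _ _)
  change _ + S.card = _ at h3
  nlinarith

/-! ### Reduction of both claims to critical hypergraphs -/

theorem exists_isTransversal_card_eq_transversalNumber {n : ℕ} {E : Finset (Finset (Fin n))}
    (hE : ∀ e ∈ E, e.card = 3) :
    ∃ T, IsTransversal E T ∧ T.card = transversalNumber E := by
  refine Nat.sInf_mem (s := {t | ∃ T, IsTransversal E T ∧ T.card = t}) ⟨_, univ, ?_, rfl⟩
  intro e he
  rw [inter_univ]
  exact card_pos.1 (by rw [hE e he]; norm_num)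

theorem IsTauCritical.isCritical {n : ℕ} {E : Finset (Finset (Fin n))} (h : IsTauCritical E)
    (hE : ∀ e ∈ E, e.card = 3) : IsCritical E (transversalNumber E) where
  card_eq := hE
  no_isolated := h.no_isolated
  le_card T hT := Nat.sInf_le ⟨T, hT, rfl⟩
  exists_erase e he := by
    obtain ⟨T, hT, hc⟩ := exists_isTransversal_card_eq_transversalNumber
      (E := E.erase e) fun g hg => hE g (mem_of_mem_erase hg)
    exact ⟨T, hT, hc ▸ h.erase_lt e he⟩

/-- A minimal subfamily `E` of `E₀` that still has transversal number `t` is critical. It has no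
isolated vertex: a vertex `v` of a minimum transversal `T` of `E₀` cannot be removed from `T`, so
some edge of `E` meets `T` in `v` only. -/
theorem exists_isCritical_of_isTransversal_cover {E₀ : Finset (Finset V)}
    (hE₀ : ∀ e ∈ E₀, e.card = 3) (hle : ∀ T, IsTransversal E₀ T → t ≤ T.card)
    (hcov : ∀ v, ∃ T, IsTransversal E₀ T ∧ T.card = t ∧ v ∈ T) :
    ∃ E : Finset (Finset V), IsCritical E t := by
  classical
  have hne : (E₀.powerset.filter fun E => ∀ T, IsTransversal E T → t ≤ T.card).Nonempty :=
    ⟨E₀, mem_filter.2 ⟨by simp, hle⟩⟩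
  obtain ⟨E, hE, hmin⟩ := exists_min_image _ card hne
  obtain ⟨hEsub, hEle⟩ := mem_filter.1 hE
  rw [mem_powerset] at hEsub
  refine ⟨E, fun e he => hE₀ e (hEsub he), fun v => ?_, hEle, fun e he => ?_⟩
  · obtain ⟨T, hT, hTt, hv⟩ := hcov v
    by_contra! hiso
    have htr : IsTransversal E (T.erase v) := fun e he => by
      obtain ⟨x, hx⟩ := hT e (hEsub he)
      obtain ⟨hxe, hxT⟩ := mem_inter.1 hx
      exact ⟨x, mem_inter.2 ⟨hxe, mem_erase.2 ⟨fun hxv => hiso e he (hxv ▸ hxe), hxT⟩⟩⟩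
    have := hEle _ htr
    rw [card_erase_of_mem hv] at this
    have := card_pos.2 ⟨v, hv⟩
    omega
  · by_contra! hcon
    have := hmin (E.erase e) (mem_filter.2
      ⟨mem_powerset.2 ((erase_subset _ _).trans hEsub), hcon⟩)
    rw [card_erase_of_mem he] at this
    have := card_pos.2 ⟨e, he⟩
    omega

/-- The triples that lie in no member of an `(n,m)`-system form a hypergraph with transversal number
`m`, and the complements of the members are minimum transversals that cover the ground set. -/
theorem IsNMSystem.exists_isCritical {n m k ℓ : ℕ} {N : Fin ℓ → Finset (Fin n)}
    (h : IsNMSystem n m k ℓ N) : ∃ E : Finset (Finset (Fin n)), IsCritical E m := by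
  have hadd := h.add_eq
  refine exists_isCritical_of_isTransversal_cover
    (E₀ := univ.filter fun e => e.card = 3 ∧ ∀ i, ¬ e ⊆ N i)
    (fun e he => (mem_filter.1 he).2.1) (fun T hT => ?_) (fun v => ?_)
  · by_contra! hlt
    obtain ⟨X, hXT, hX⟩ := exists_subset_card_eq (s := Tᶜ) (n := k + 1) (by
      rw [card_compl, Fintype.card_fin]
      omega)
    obtain ⟨e, heX, he3, heN⟩ := h.exists_triple X hX
    obtain ⟨x, hx⟩ := hT e (mem_filter.2 ⟨mem_univ _, he3, heN⟩)
    obtain ⟨hxe, hxT⟩ := mem_inter.1 hx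
    exact mem_compl.1 (hXT (heX hxe)) hxT
  · have hv : v ∉ ⋂ i, (N i : Set (Fin n)) := by simp [h.iInter_eq]
    simp only [Set.mem_iInter, mem_coe, not_forall] at hv
    obtain ⟨i, hi⟩ := hv
    refine ⟨(N i)ᶜ, fun e he => ?_, ?_, mem_compl.2 hi⟩
    · obtain ⟨x, hxe, hx⟩ := not_subset.1 ((mem_filter.1 he).2.2 i)
      exact ⟨x, mem_inter.2 ⟨hxe, mem_compl.2 hx⟩⟩
    · rw [card_compl, Fintype.card_fin, h.card_eq]
      omega

end

theorem theorem3 :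
    (∀ (n m k ℓ : ℕ) (N : Fin ℓ → Finset (Fin n)),
      IsNMSystem n m k ℓ N → n ≤ m ^ 2 + 6 * m + 2) ∧
    (∀ (n m : ℕ) (E : Finset (Finset (Fin n))),
      (∀ e ∈ E, e.card = 3) → IsTauCritical E → transversalNumber E = m →
        n ≤ m ^ 2 + 6 * m + 2) := by
  have key : ∀ (n m : ℕ) (E : Finset (Finset (Fin n))), IsCritical E m →
      n ≤ m ^ 2 + 6 * m + 2 := fun n m E h => by
    have := h.two_mul_card_le
    rw [Fintype.card_fin] at this
    omega
  refine ⟨fun n m k ℓ N h => ?_, fun n m E hE h hm => ?_⟩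
  · obtain ⟨E, hE⟩ := h.exists_isCritical
    exact key n m E hE
  · exact key n m E (hm ▸ h.isCritical hE)
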